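/- Let $p,N\ge 0$ be integers, $w_1,\dots,w_N\in\mathbb R^p$, $z_1,\dots,z_N\in\mathbb R$ (for instance $z_i\in\{0,1\}$), $b\in\mathbb R^p$, let $B$ be a positive definite $p\times p$ matrix and $\tau>0$. For a positive (possibly unnormalised) density $m$ on $\mathbb R^p$ let $\mathcal P^{m}$ be the Metropolis kernel with Gaussian random-walk proposal density $q^*(x,y)=|2\pi\tau^2 I|^{-1/2}e^{-\|\tau^{-1}(y-x)\|^2/2}$, that is, $$\mathcal P^{m}(x,dy)=\alpha(x,y)\,q^*(x,y)\,dy+\Big(\int(1-\alpha(x,u))\,q^*(x,u)\,du\Big)\,\delta_x(dy),\qquad \alpha(x,y)=1\wedge\frac{m(y)}{m(x)} .$$ For $V:\mathbb R^p\to[0,\infty)$ measurable and $\beta\ge 0$ put $d_\beta(x,y)=2+\beta V(x)+\beta V(y)$ if $x\ne y$ and $d_\beta(x,x)=0$. For probability measures $\mu,\nu$ let $d_\beta(\mu,\nu)=\sup_\varphi\big(\int\varphi\,d\mu-\int\varphi\,d\nu\big)\in[0,\infty]$, where the supremum is over the measurable, $\mu$- and $\nu$-integrable $\varphi$ with $|\varphi(x)-\varphi(y)|\le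 d_\beta(x,y)$ for all $x,y$; $d_0$ is the total variation metric. Call $V$ a Lyapunov function of a Markov kernel $\mathcal P$ if there are $\gamma\in(0,1)$ and $K>0$ with $(\mathcal PV)(x)\le\gamma V(x)+K$ for all $x$. (1) Let $m$ be a positive function which, for some constant $C$, satisfies $$\log m(x)=\sum_{i=1}^N\Big(z_i\langle w_i,x\rangle-\log\big(1+e^{\langle w_i,x\rangle}\big)\Big)-\tfrac12\|B^{-1/2}(x-b)\|^2+C\qquad(x\in\mathbb R^p),$$ and let $\mathcal P=\mathcal P^{m}$. Then there are $c,s>0$ such that, with $V(x)=c\,e^{s\|x\|}$: (a) $V$ is a Lyapunov function of $\mathcal P$; (b) for every $R>0$ there is $\bar\alpha_0\in(0,1)$ with $\sup\{d_0(\delta_x\mathcal P,\delta_y\mathcal P): V(x)\le R,\ V(y)\le R\}\le 2\bar\alpha_0$; (c) there are $\bar\alpha\in(0,1)$ and $\beta>0$ with $d_\beta(\nu_1\mathcal P,\nu_2\mathcal P)\le\bar\alpha\,d_\beta(\nu_1,\nu_2)$ for all probability measures $\nu_1,\nu_2$ on $\mathbb R^p$. (2) Let $\mathcal A\subseteq\{1,\dots,N\}$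 be non-empty, let $m_{\mathcal A}$ be a positive function which, for some constant $C$, satisfies $$\log m_{\mathcal A}(x)=\frac N{|\mathcal A|}\sum_{i\in\mathcal A}\Big(z_i\langle w_i,x\rangle-\log\big(1+e^{\langle w_i,x\rangle}\big)\Big)-\tfrac12\|B^{-1/2}(x-b)\|^2+C\qquad(x\in\mathbb R^p),$$ and let $\mathcal P_{\mathcal A}=\mathcal P^{m_{\mathcal A}}$. Then there are $c_{\mathcal A},s_{\mathcal A}>0$ such that $V_{\mathcal A}(x)=c_{\mathcal A}\,e^{s_{\mathcal A}\|x\|}$ is a Lyapunov function of $\mathcal P_{\mathcal A}$. -/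

import Mathlib

open MeasureTheory ProbabilityTheory
open scoped ENNReal MatrixOrder

noncomputable section

namespace RWM

/-! ### Weighted total variation and Harris' theorem -/

section Harris

variable {X : Type*} [MeasurableSpace X]

open Classical in
/-- The weighted discrete metric `d_β(x,y) = 2 + β V(x) + β V(y)` for `x ≠ y`, and `0` for `x = y`. -/
def dPoint (V : X → ℝ) (β : ℝ) (x y : X) : ℝ :=
  if x = y then 0 else 2 + β * V x + β * V y

/-- The induced dual metric on probability measures: the supremum of `∫ φ d(μ - ν)` over measurable
`φ` that are `1`-Lipschitz for `d_β`. Only those `φ` enter for which `∫ φ d(μ - ν)` makes sense;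
the supremum is taken in `[0, ∞]`, and `d_β(μ,ν) = ∞` is possible.
For `β = 0` this is the total variation metric, the dual metric of `2 · 1(x ≠ y)`. -/
def dMeas (V : X → ℝ) (β : ℝ) (μ ν : Measure X) : ℝ≥0∞ :=
  ⨆ (φ : X → ℝ) (_ : Measurable φ) (_ : Integrable φ μ) (_ : Integrable φ ν)
    (_ : ∀ x y, |φ x - φ y| ≤ dPoint V β x y),
    ENNReal.ofReal (∫ x, φ x ∂μ - ∫ x, φ x ∂ν)

/-- The total variation metric `d_0`, normalised so that it takes values in `[0, 2]`. -/
def dTV (μ ν : Measure X) : ℝ≥0∞ := dMeas (fun _ => 0) 0 μ ν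

/-- `V : X → [0, ∞)` is a (Foster–)Lyapunov function of `P`: `P V ≤ γ V + K` for some
`γ ∈ (0,1)`, `K > 0`. -/
def IsLyapunov (P : Kernel X X) (V : X → ℝ) : Prop :=
  Measurable V ∧ (∀ x, 0 ≤ V x) ∧
    ∃ γ K : ℝ, 0 < γ ∧ γ < 1 ∧ 0 < K ∧
      ∀ x, ∫⁻ y, ENNReal.ofReal (V y) ∂(P x) ≤ ENNReal.ofReal (γ * V x + K)

/-- The sublevel sets of `V` are small for `P`. -/
def SmallSublevels (P : Kernel X X) (V : X → ℝ) : Prop :=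
  ∀ R : ℝ, 0 < R → ∃ a : ℝ, 0 < a ∧ a < 1 ∧
    (⨆ (x ∈ {x | V x ≤ R}) (y ∈ {y | V y ≤ R}), dTV (P x) (P y)) ≤ ENNReal.ofReal (2 * a)

/-- `P` is a strict contraction on probability measures in `d_β`, for some `β > 0`. Here
`ν.bind P` is the measure `ν P = ∫ P(x, ·) ν(dx)`. -/
def HarrisContraction (P : Kernel X X) (V : X → ℝ) : Prop :=
  ∃ a β : ℝ, 0 < a ∧ a < 1 ∧ 0 < β ∧
    ∀ ν₁ ν₂ : Measure X, IsProbabilityMeasure ν₁ → IsProbabilityMeasure ν₂ →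
      dMeas V β (ν₁.bind P) (ν₂.bind P) ≤ ENNReal.ofReal a * dMeas V β ν₁ ν₂

/-- Harris' theorem holds for `P` with Lyapunov function `V`: both of its assumptions and its
conclusion. -/
def HarrisHolds (P : Kernel X X) (V : X → ℝ) : Prop :=
  IsLyapunov P V ∧ SmallSublevels P V ∧ HarrisContraction P V

end Harris

/-! ### The Gaussian random walk Metropolis kernel -/

variable {p N : ℕ}

/-- The density of the isotropic Gaussian proposal, `|2πτ²I|^{-1/2} exp(-‖τ⁻¹(y - x)‖²/2)`. -/
def gaussProposal (τ : ℝ) (x y : EuclideanSpace ℝ (Fin p)) : ℝ :=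
  (((2 * Real.pi * τ ^ 2) • (1 : Matrix (Fin p) (Fin p) ℝ)).det) ^ (-(1 / 2) : ℝ) *
    Real.exp (-(‖τ⁻¹ • (y - x)‖ ^ 2 / 2))

lemma measurable_gaussProposal (τ : ℝ) :
    Measurable (fun q : EuclideanSpace ℝ (Fin p) × EuclideanSpace ℝ (Fin p) =>
      gaussProposal τ q.1 q.2) := by
  unfold gaussProposal
  fun_prop

/-- The Metropolis acceptance probability `1 ∧ m(y)/m(x)` (the proposal is symmetric). -/
def accept (m : EuclideanSpace ℝ (Fin p) → ℝ) (x y : EuclideanSpace ℝ (Fin p)) : ℝ :=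
  min 1 (m y / m x)

lemma measurable_accept {m : EuclideanSpace ℝ (Fin p) → ℝ} (hm : Measurable m) :
    Measurable (fun q : EuclideanSpace ℝ (Fin p) × EuclideanSpace ℝ (Fin p) =>
      accept m q.1 q.2) := by
  unfold accept
  fun_prop

/-- The Metropolis kernel with Gaussian random walk proposal and (unnormalised) target density `m`:
`P(x, dy) = α(x,y) q(x,y) dy + (∫ (1 - α(x,u)) q(x,u) du) δ_x(dy)`. -/
def metropolis (τ : ℝ) (m : EuclideanSpace ℝ (Fin p) → ℝ) (hm : Measurable m) :
    Kernel (EuclideanSpace ℝ (Fin p)) (EuclideanSpace ℝ (Fin p)) where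
  toFun x :=
    volume.withDensity (fun y => ENNReal.ofReal (accept m x y * gaussProposal τ x y)) +
      (∫⁻ u, ENNReal.ofReal ((1 - accept m x u) * gaussProposal τ x u)) • Measure.dirac x
  measurable' := by
    have hq := measurable_gaussProposal (p := p) τ
    have ha := measurable_accept hm
    refine Measure.measurable_of_measurable_coe _ fun s hs => ?_
    have h1 : Measurable fun x : EuclideanSpace ℝ (Fin p) =>
        ∫⁻ y in s, ENNReal.ofReal (accept m x y * gaussProposal τ x y) :=
      Measurable.lintegral_prod_right' (ν := volume.restrict s) (ha.mul hq).ennreal_ofReal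
    have h2 : Measurable fun x : EuclideanSpace ℝ (Fin p) =>
        ∫⁻ u, ENNReal.ofReal ((1 - accept m x u) * gaussProposal τ x u) :=
      Measurable.lintegral_prod_right' (ν := volume)
        ((measurable_const.sub ha).mul hq).ennreal_ofReal
    have h3 : Measurable fun x : EuclideanSpace ℝ (Fin p) =>
        (Measure.dirac x : Measure (EuclideanSpace ℝ (Fin p))) s :=
      (Measure.measurable_coe hs).comp Measure.measurable_dirac
    simp only [Measure.coe_add, Pi.add_apply, Measure.smul_apply, smul_eq_mul,
      withDensity_apply _ hs]
    exact h1.add (h2.mul h3)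

/-! ### Bayesian logistic regression with a Gaussian prior -/

/-- `-½ ‖B^{-1/2} (x - b)‖²`, the logarithm of the Gaussian prior density up to a constant. -/
def logPrior (b : EuclideanSpace ℝ (Fin p)) (B : Matrix (Fin p) (Fin p) ℝ)
    (x : EuclideanSpace ℝ (Fin p)) : ℝ :=
  -(1 / 2) * ‖Matrix.toEuclideanLin (B ^ (-(1 / 2) : ℝ)) (x - b)‖ ^ 2

/-- `z_i ⟨w_i, x⟩ - log (1 + e^{⟨w_i, x⟩})`, the contribution of the `i`-th observation to the
logistic log-likelihood. -/
def logLikTerm (w : Fin N → EuclideanSpace ℝ (Fin p)) (z : Fin N → ℝ) (i : Fin N)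
    (x : EuclideanSpace ℝ (Fin p)) : ℝ :=
  z i * inner ℝ (w i) x - Real.log (1 + Real.exp (inner ℝ (w i) x))

/-- The logarithm of the posterior density, up to an additive constant. -/
def logPost (w : Fin N → EuclideanSpace ℝ (Fin p)) (z : Fin N → ℝ)
    (b : EuclideanSpace ℝ (Fin p)) (B : Matrix (Fin p) (Fin p) ℝ)
    (x : EuclideanSpace ℝ (Fin p)) : ℝ :=
  (∑ i, logLikTerm w z i x) + logPrior b B x

/-- The logarithm of the minibatch target density for the subset `A`, up to an additive
constant. -/
def logPostBatch (w : Fin N → EuclideanSpace ℝ (Fin p)) (z : Fin N → ℝ)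
    (b : EuclideanSpace ℝ (Fin p)) (B : Matrix (Fin p) (Fin p) ℝ) (A : Finset (Fin N))
    (x : EuclideanSpace ℝ (Fin p)) : ℝ :=
  (N : ℝ) / (A.card : ℝ) * (∑ i ∈ A, logLikTerm w z i x) + logPrior b B x

/-- `m` is a positive density with `log m = U` up to an additive constant. -/
def HasLogDensity (m U : EuclideanSpace ℝ (Fin p) → ℝ) : Prop :=
  (∀ x, 0 < m x) ∧ ∃ C : ℝ, ∀ x, Real.log (m x) = U x + C

lemma HasLogDensity.measurable {m U : EuclideanSpace ℝ (Fin p) → ℝ} (h : HasLogDensity m U)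
    (hU : Measurable U) : Measurable m := by
  obtain ⟨hpos, C, hC⟩ := h
  have : m = fun x => Real.exp (U x + C) := by
    funext x
    rw [← hC x, Real.exp_log (hpos x)]
  rw [this]
  fun_prop

lemma measurable_logPrior (b : EuclideanSpace ℝ (Fin p)) (B : Matrix (Fin p) (Fin p) ℝ) :
    Measurable (logPrior b B) := by
  have h : Continuous (Matrix.toEuclideanLin (B ^ (-(1 / 2) : ℝ))) :=
    LinearMap.continuous_of_finiteDimensional _
  have : Continuous (logPrior b B) := by
    unfold logPrior
    exact continuous_const.mul ((h.comp (continuous_id.sub continuous_const)).norm.pow 2)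
  exact this.measurable

lemma measurable_logLikTerm (w : Fin N → EuclideanSpace ℝ (Fin p)) (z : Fin N → ℝ) (i : Fin N) :
    Measurable (logLikTerm w z i) := by
  unfold logLikTerm
  fun_prop

lemma measurable_logPost (w : Fin N → EuclideanSpace ℝ (Fin p)) (z : Fin N → ℝ)
    (b : EuclideanSpace ℝ (Fin p)) (B : Matrix (Fin p) (Fin p) ℝ) :
    Measurable (logPost w z b B) :=
  (Finset.measurable_fun_sum _ fun i _ => measurable_logLikTerm w z i).add
    (measurable_logPrior b B)

lemma measurable_logPostBatch (w : Fin N → EuclideanSpace ℝ (Fin p)) (z : Fin N → ℝ)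
    (b : EuclideanSpace ℝ (Fin p)) (B : Matrix (Fin p) (Fin p) ℝ) (A : Finset (Fin N)) :
    Measurable (logPostBatch w z b B A) :=
  (measurable_const.mul (Finset.measurable_fun_sum _ fun i _ => measurable_logLikTerm w z i)).add
    (measurable_logPrior b B)

end RWM

end

/-!
The logarithm of each target density is a Lipschitz function (the logistic log-likelihood) minus the
positive definite quadratic form `½ ‖M (x - b)‖²` with `M = B^{-1/2}`; this is the content of
`IsGaussianPerturbation`, and nothing else about the target is used.

*Drift.* With `u = y - x` the increment of the chain, `V(x) = e^{s‖x‖}` satisfies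
`P V = V · (1 + ∫ α(x, x+u) (e^{s(‖x+u‖ - ‖x‖)} - 1) q(u) du)`. For small `s` the integral is
governed by its first-order term, the expected norm increment
`D(x) = ∫ α(x, x+u) (‖x+u‖ - ‖x‖) q(u) du`, so it suffices that `D` is bounded above by a negative
constant outside a ball (`IsGaussianPerturbation.exists_integral_norm_increment_le`). Otherwise
there would be a sequence `x_k` with `‖x_k‖ → ∞`, `liminf D(x_k) ≥ 0` and, by compactness of the
sphere, `x_k / ‖x_k‖ → n`. Along it the quadratic form dominates the Lipschitz part, so the
acceptance probability tends to the indicator of the half-space `⟨v, u⟩ < 0` with `v = Mᵀ M n`,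
while `‖x_k + u‖ - ‖x_k‖ → ⟨n, u⟩`. By dominated convergence
`D(x_k) → ∫_{⟨v, u⟩ < 0} ⟨n, u⟩ q(u) du`. The proposal being isotropic, averaging over the
reflection in the line of `v` turns the integrand into `⟨n, v⟩ ⟨v, u⟩ / ‖v‖²`, which is
negative on the half-space because `⟨n, v⟩ = ‖M n‖² > 0`
(`integral_halfSpace_inner_mul_gaussProposal_neg`): a contradiction.

*Small sets.* The density `α(x, y) q(x, y)` is continuous and positive, hence bounded below for `x`
in a given ball and `y` in the unit ball. So the transition probabilities from a sublevel set of `V`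
share a common part of positive mass (`smallSublevels_metropolis`, `dTV_le_of_common_minorant`).

*Contraction.* Harris' theorem (`IsLyapunov.harrisContraction`) is proved by duality: it suffices
that `P` maps `1`-Lipschitz functions for `d_β` to `a`-Lipschitz ones. Such a function is, up to a
constant, bounded by `1 + β V`. For two points with `V(x) + V(y)` large the drift condition gives
the contraction; for the others, the function is split into a part bounded by `1`, contracted since
the sublevel set is small, and a part bounded by `β V`, whose contribution is controlled by taking
`β` small.
-/

namespace RWM

/-! ### Harris' theorem for the weighted total variation metric -/

section Harris

lemma dPoint_of_ne {X : Type*} (V : X → ℝ) (β : ℝ) {x y : X} (h : x ≠ y) :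
    dPoint V β x y = 2 + β * V x + β * V y := if_neg h

lemma dPoint_self {X : Type*} (V : X → ℝ) (β : ℝ) (x : X) : dPoint V β x x = 0 := if_pos rfl

/-- A function that is `1`-Lipschitz for `d_β` is, after addition of a constant, dominated by
the weight `1 + β V`. -/
lemma exists_abs_add_le_of_lipschitz {X : Type*} {V φ : X → ℝ} {β : ℝ} (hβ : 0 ≤ β)
    (hV : ∀ x, 0 ≤ V x) (hφ : ∀ x y, |φ x - φ y| ≤ dPoint V β x y) :
    ∃ c : ℝ, ∀ x, |φ x + c| ≤ 1 + β * V x := by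
  rcases isEmpty_or_nonempty X with hX | hX
  · exact ⟨0, fun x => hX.elim x⟩
  have key : ∀ x y, -(1 + β * V y) - φ y ≤ 1 + β * V x - φ x := by
    intro x y
    have hx := mul_nonneg hβ (hV x)
    have hy := mul_nonneg hβ (hV y)
    by_cases h : x = y
    · subst h; linarith
    · have := (abs_le.1 (hφ x y)).2
      rw [dPoint_of_ne V β h] at this
      linarith
  obtain ⟨x₀⟩ := hX
  have hbdd : BddBelow (Set.range fun x => 1 + β * V x - φ x) := by
    refine ⟨-(1 + β * V x₀) - φ x₀, ?_⟩
    rintro _ ⟨x, rfl⟩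
    exact key x x₀
  have : Nonempty X := ⟨x₀⟩
  refine ⟨⨅ x, (1 + β * V x - φ x), fun x => abs_le.2 ⟨?_, ?_⟩⟩
  · have := le_ciInf (fun y => key y x)
    linarith
  · have := ciInf_le hbdd x
    linarith

variable {X : Type*} [MeasurableSpace X]

/-- Two probability measures that dominate a common measure of mass `ε` have total variation
distance at most `2 (1 - ε)`. -/
lemma dTV_le_of_common_minorant {μ ν κ : Measure X} [IsProbabilityMeasure μ]
    [IsProbabilityMeasure ν] (hμ : κ ≤ μ) (hν : κ ≤ ν) :
    dTV μ ν ≤ ENNReal.ofReal (2 * (1 - κ.real Set.univ)) := by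
  have : IsFiniteMeasure κ := isFiniteMeasure_of_le μ hμ
  refine iSup_le fun φ => iSup_le fun hφm => iSup_le fun hφμ => iSup_le fun hφν =>
    iSup_le fun hφ => ENNReal.ofReal_le_ofReal ?_
  obtain ⟨c, hc⟩ := exists_abs_add_le_of_lipschitz le_rfl (fun _ => le_rfl) hφ
  simp only [mul_zero, add_zero] at hc
  have hφκ : Integrable φ κ := hφμ.mono_measure hμ
  -- With `ψ = φ + c ∈ [-1, 1]`, compare the non-negative functions `1 - ψ` and `1 + ψ`.
  have h1 : ∫ x, (1 - (φ x + c)) ∂κ ≤ ∫ x, (1 - (φ x + c)) ∂μ :=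
    integral_mono_measure hμ
      (Filter.Eventually.of_forall fun x => sub_nonneg.2 (abs_le.1 (hc x)).2)
      ((integrable_const _).sub (hφμ.add (integrable_const _)))
  have h2 : ∫ x, (1 + (φ x + c)) ∂κ ≤ ∫ x, (1 + (φ x + c)) ∂ν :=
    integral_mono_measure hν
      (Filter.Eventually.of_forall fun x => neg_le_iff_add_nonneg'.1 (abs_le.1 (hc x)).1)
      ((integrable_const _).add (hφν.add (integrable_const _)))
  have e (ρ : Measure X) [IsFiniteMeasure ρ] (h : Integrable φ ρ) :
      ∫ x, (φ x + c) ∂ρ = ∫ x, φ x ∂ρ + c * ρ.real Set.univ := by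
    rw [integral_add h (integrable_const _), integral_const, smul_eq_mul, mul_comm]
  have i (ρ : Measure X) [IsFiniteMeasure ρ] (h : Integrable φ ρ) :
      Integrable (fun x => φ x + c) ρ := h.add (integrable_const _)
  rw [integral_sub (integrable_const _) (i κ hφκ), integral_sub (integrable_const _) (i μ hφμ),
    e κ hφκ, e μ hφμ, integral_const, integral_const, probReal_univ (μ := μ)] at h1
  rw [integral_add (integrable_const _) (i κ hφκ), integral_add (integrable_const _) (i ν hφν),
    e κ hφκ, e ν hφν, integral_const, integral_const, probReal_univ (μ := ν)] at h2
  simp only [smul_eq_mul, mul_one] at h1 h2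
  linarith

/-- The total variation distance bounds the difference of the integrals of a function with values
in `[-1, 1]`. -/
lemma integral_sub_integral_le_of_dTV_le {μ ν : Measure X} [IsFiniteMeasure μ] [IsFiniteMeasure ν]
    {φ : X → ℝ} (hm : Measurable φ) (hφ : ∀ x, |φ x| ≤ 1) {r : ℝ} (hr : 0 ≤ r)
    (h : dTV μ ν ≤ ENNReal.ofReal r) : ∫ x, φ x ∂μ - ∫ x, φ x ∂ν ≤ r := by
  have hint (ρ : Measure X) [IsFiniteMeasure ρ] : Integrable φ ρ :=
    Integrable.of_bound hm.aestronglyMeasurable 1 (Filter.Eventually.of_forall hφ)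
  have hlip : ∀ x y, |φ x - φ y| ≤ dPoint (fun _ => 0) 0 x y := by
    intro x y
    by_cases hxy : x = y
    · subst hxy; simp [dPoint_self]
    · rw [dPoint_of_ne _ _ hxy]
      have := abs_sub (φ x) (φ y)
      linarith [hφ x, hφ y]
  refine (ENNReal.ofReal_le_ofReal_iff hr).1 (le_trans ?_ h)
  exact le_iSup_of_le φ <| le_iSup_of_le hm <| le_iSup_of_le (hint μ) <| le_iSup_of_le (hint ν) <|
    le_iSup_of_le hlip le_rfl

lemma integrable_of_lintegral_ofReal_le {μ : Measure X} {V : X → ℝ} (hm : Measurable V)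
    (h0 : ∀ x, 0 ≤ V x) {r : ℝ} (h : ∫⁻ y, ENNReal.ofReal (V y) ∂μ ≤ ENNReal.ofReal r) :
    Integrable V μ :=
  ⟨hm.aestronglyMeasurable, by
    rw [hasFiniteIntegral_iff_ofReal (Filter.Eventually.of_forall h0)]
    exact h.trans_lt ENNReal.ofReal_lt_top⟩

lemma integral_le_of_lintegral_ofReal_le {μ : Measure X} {V : X → ℝ} (hm : Measurable V)
    (h0 : ∀ x, 0 ≤ V x) {r : ℝ} (hr : 0 ≤ r)
    (h : ∫⁻ y, ENNReal.ofReal (V y) ∂μ ≤ ENNReal.ofReal r) : ∫ y, V y ∂μ ≤ r := by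
  rw [integral_eq_lintegral_of_nonneg_ae (Filter.Eventually.of_forall h0) hm.aestronglyMeasurable]
  exact ENNReal.toReal_le_of_le_ofReal hr h

/-- If `P` maps `1`-Lipschitz functions for `d_β` to `a`-Lipschitz ones, then it contracts the dual
metric by the factor `a`. -/
lemma dMeas_bind_le_of_lipschitz {P : Kernel X X} [IsMarkovKernel P] {V : X → ℝ} {a β : ℝ}
    (ha : 0 < a)
    (hP : ∀ φ : X → ℝ, Measurable φ → (∀ x y, |φ x - φ y| ≤ dPoint V β x y) →
      ∀ x y, ∫ u, φ u ∂(P x) - ∫ u, φ u ∂(P y) ≤ a * dPoint V β x y)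
    (ν₁ ν₂ : Measure X) [IsProbabilityMeasure ν₁] [IsProbabilityMeasure ν₂] :
    dMeas V β (ν₁.bind P) (ν₂.bind P) ≤ ENNReal.ofReal a * dMeas V β ν₁ ν₂ := by
  refine iSup_le fun φ => iSup_le fun hφm => iSup_le fun hφ₁ => iSup_le fun hφ₂ =>
    iSup_le fun hφ => ?_
  have e {ν : Measure X} (h : Integrable φ (ν.bind P)) :
      ∫ x, φ x ∂(ν.bind P) = ∫ x, ∫ u, φ u ∂(P x) ∂ν := by
    rw [Measure.comp_eq_comp_const_apply] at h ⊢
    rw [Kernel.integral_comp h, Kernel.const_apply]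
  have i {ν : Measure X} (h : Integrable φ (ν.bind P)) :
      Integrable (fun x => ∫ u, φ u ∂(P x)) ν := by
    rw [Measure.comp_eq_comp_const_apply] at h
    simpa only [Kernel.const_apply] using h.integral_comp
  have hm : Measurable fun x => a⁻¹ * ∫ u, φ u ∂(P x) :=
    (hφm.stronglyMeasurable.integral_kernel (κ := P)).measurable.const_mul _
  have hsymm : ∀ x y, dPoint V β x y = dPoint V β y x := by
    intro x y
    by_cases h : x = y
    · subst h; rfl
    · rw [dPoint_of_ne _ _ h, dPoint_of_ne _ _ (Ne.symm h)]; ring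
  have hlip : ∀ x y, |a⁻¹ * ∫ u, φ u ∂(P x) - a⁻¹ * ∫ u, φ u ∂(P y)| ≤ dPoint V β x y := by
    intro x y
    rw [← mul_sub, abs_mul, abs_of_pos (inv_pos.2 ha), inv_mul_le_iff₀ ha]
    refine abs_le.2 ⟨?_, hP φ hφm hφ x y⟩
    have := hP φ hφm hφ y x
    rw [hsymm y x] at this
    linarith
  have key : ENNReal.ofReal (∫ x, a⁻¹ * ∫ u, φ u ∂(P x) ∂ν₁ - ∫ x, a⁻¹ * ∫ u, φ u ∂(P x) ∂ν₂)
      ≤ dMeas V β ν₁ ν₂ :=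
    le_iSup_of_le _ <| le_iSup_of_le hm <| le_iSup_of_le ((i hφ₁).const_mul _) <|
      le_iSup_of_le ((i hφ₂).const_mul _) <| le_iSup_of_le hlip le_rfl
  calc ENNReal.ofReal (∫ x, φ x ∂(ν₁.bind P) - ∫ x, φ x ∂(ν₂.bind P))
      = ENNReal.ofReal (a * (∫ x, a⁻¹ * ∫ u, φ u ∂(P x) ∂ν₁
          - ∫ x, a⁻¹ * ∫ u, φ u ∂(P x) ∂ν₂)) := by
        rw [e hφ₁, e hφ₂, integral_const_mul, integral_const_mul, ← mul_sub,
          mul_inv_cancel_left₀ ha.ne']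
    _ ≤ ENNReal.ofReal a * dMeas V β ν₁ ν₂ := by
        rw [ENNReal.ofReal_mul ha.le]
        gcongr

/-- **Harris' theorem**: a Markov kernel with a Lyapunov function whose sublevel sets are small is
a strict contraction of `d_β` for a suitable `β > 0`. -/
theorem IsLyapunov.harrisContraction {P : Kernel X X} [IsMarkovKernel P] {V : X → ℝ}
    (hV : IsLyapunov P V) (hS : SmallSublevels P V) : HarrisContraction P V := by
  obtain ⟨hVm, hV0, γ, K, hγ0, hγ1, hK, hPV⟩ := hV
  -- The level `R` exceeds `2 K / (1 - γ)`, so that the drift contracts outside `{V x + V y < R}`.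
  set R : ℝ := 4 * K / (1 - γ) with hR
  have h1γ : 0 < 1 - γ := by linarith
  have hR0 : 0 < R := by positivity
  have hRγ : (1 - γ) * R = 4 * K := by rw [hR]; field_simp
  obtain ⟨a₀, ha₀, ha₀1, hsmall⟩ := hS R hR0
  -- With this `β`, the constant `K` of the drift costs less than half of the mixing `1 - a₀`.
  set β : ℝ := (1 - a₀) / (2 * K) with hβ
  have hβ0 : 0 < β := div_pos (by linarith) (by positivity)
  have hβK : β * K = (1 - a₀) / 2 := by rw [hβ]; field_simp
  set a₁ : ℝ := (2 + 2 * (β * K) + γ * (β * R)) / (2 + β * R) with ha₁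
  have hβR : 0 < β * R := mul_pos hβ0 hR0
  have ha₁eq : a₁ * (2 + β * R) = 2 + 2 * (β * K) + γ * (β * R) := by rw [ha₁]; field_simp
  have hβRγ : β * R - γ * (β * R) = 4 * (β * K) := by linear_combination β * hRγ
  have ha₁1 : a₁ < 1 := by
    rw [ha₁, div_lt_one (by positivity)]
    nlinarith [mul_pos hβ0 hK]
  have ha₁γ : γ ≤ a₁ := by
    rw [ha₁, le_div_iff₀ (by positivity)]
    nlinarith [mul_pos hβ0 hK]
  set a : ℝ := max ((1 + a₀) / 2) a₁ with ha
  have haa₀ : (1 + a₀) / 2 ≤ a := le_max_left _ _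
  have haa₁ : a₁ ≤ a := le_max_right _ _
  have ha1 : a < 1 := max_lt (by linarith) ha₁1
  have ha0 : 0 < a := by linarith
  refine ⟨a, β, ha0, ha1, hβ0, fun ν₁ ν₂ _ _ => dMeas_bind_le_of_lipschitz ha0 ?_ ν₁ ν₂⟩
  intro φ hφm hφ x y
  by_cases hxy : x = y
  · subst hxy; simp [dPoint_self]
  rw [dPoint_of_ne _ _ hxy]
  obtain ⟨c, hc⟩ := exists_abs_add_le_of_lipschitz hβ0.le hV0 hφ
  have hVi : ∀ x, Integrable V (P x) := fun x => integrable_of_lintegral_ofReal_le hVm hV0 (hPV x)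
  have hVle : ∀ x, ∫ u, V u ∂(P x) ≤ γ * V x + K := fun x =>
    integral_le_of_lintegral_ofReal_le hVm hV0 (by have := hV0 x; positivity) (hPV x)
  have hψm : Measurable fun u => φ u + c := hφm.add_const c
  have hψi : ∀ x, Integrable (fun u => φ u + c) (P x) := fun x =>
    ((integrable_const (1 : ℝ)).add ((hVi x).const_mul β)).mono' hψm.aestronglyMeasurable
      (Filter.Eventually.of_forall hc)
  have hφi : ∀ x, Integrable φ (P x) := fun x => by
    simpa using ((hψi x).add (integrable_const (-c))).congr
      (Filter.Eventually.of_forall fun u => add_neg_cancel_right (φ u) c)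
  have hshift : ∀ x, ∫ u, φ u ∂(P x) = ∫ u, (φ u + c) ∂(P x) - c := fun x => by
    rw [integral_add (hφi x) (integrable_const c)]; simp
  rw [hshift x, hshift y]
  have hVx := hV0 x
  have hVy := hV0 y
  have hβVx := mul_le_mul_of_nonneg_left (hVle x) hβ0.le
  have hβVy := mul_le_mul_of_nonneg_left (hVle y) hβ0.le
  rcases le_or_gt R (V x + V y) with hS' | hS'
  · have hup : ∫ u, (φ u + c) ∂(P x) ≤ 1 + β * ∫ u, V u ∂(P x) := by
      have := integral_mono (hψi x) ((integrable_const (1 : ℝ)).add ((hVi x).const_mul β))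
        fun u => (abs_le.1 (hc u)).2
      simp only [Pi.add_apply] at this
      rwa [integral_add (integrable_const _) ((hVi x).const_mul β), integral_const_mul,
        integral_const, probReal_univ, one_smul] at this
    have hlo : -(1 + β * ∫ u, V u ∂(P y)) ≤ ∫ u, (φ u + c) ∂(P y) := by
      have := integral_mono (((integrable_const (1 : ℝ)).add ((hVi y).const_mul β)).neg) (hψi y)
        fun u => (abs_le.1 (hc u)).1
      simp only [Pi.add_apply, Pi.neg_apply] at this
      rwa [integral_neg, integral_add (integrable_const _) ((hVi y).const_mul β),
        integral_const_mul, integral_const, probReal_univ, one_smul] at this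
    have hβS : β * R ≤ β * (V x + V y) := mul_le_mul_of_nonneg_left hS' hβ0.le
    nlinarith [mul_le_mul_of_nonneg_left hβS (sub_nonneg.2 ha₁γ),
      mul_nonneg (sub_nonneg.2 haa₁) (by positivity : 0 ≤ 2 + β * (V x + V y))]
  · -- Split `ψ = φ + c` into its truncation to `[-1, 1]` and a remainder dominated by `β V`.
    set ψ₁ : X → ℝ := fun u => max (-1) (min 1 (φ u + c)) with hψ₁
    have hψ₁m : Measurable ψ₁ := measurable_const.max (measurable_const.min hψm)
    have hψ₁b : ∀ u, |ψ₁ u| ≤ 1 := fun u =>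
      abs_le.2 ⟨le_max_left _ _, max_le (by norm_num) (min_le_left _ _)⟩
    have hψ₁i : ∀ x, Integrable ψ₁ (P x) := fun x =>
      Integrable.of_bound hψ₁m.aestronglyMeasurable 1 (Filter.Eventually.of_forall hψ₁b)
    have hrem : ∀ u, |φ u + c - ψ₁ u| ≤ β * V u := by
      intro u
      have h1 := abs_le.1 (hc u)
      have h0 := mul_nonneg hβ0.le (hV0 u)
      simp only [hψ₁]
      rcases le_total 1 (φ u + c) with h | h
      · rw [min_eq_left h, max_eq_right (by norm_num), abs_le]
        constructor <;> linarith
      · rw [min_eq_right h]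
        rcases le_total (-1) (φ u + c) with h' | h'
        · rw [max_eq_right h', sub_self, abs_zero]; exact h0
        · rw [max_eq_left h', abs_le]
          constructor <;> linarith
    have hremx : ∫ u, (φ u + c - ψ₁ u) ∂(P x) ≤ β * ∫ u, V u ∂(P x) := by
      rw [← integral_const_mul]
      exact integral_mono ((hψi x).sub (hψ₁i x)) ((hVi x).const_mul β)
        fun u => (abs_le.1 (hrem u)).2
    have hremy : -(β * ∫ u, V u ∂(P y)) ≤ ∫ u, (φ u + c - ψ₁ u) ∂(P y) := by
      rw [← integral_const_mul, ← integral_neg]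
      exact integral_mono ((hVi y).const_mul β).neg ((hψi y).sub (hψ₁i y))
        fun u => (abs_le.1 (hrem u)).1
    rw [integral_sub (hψi x) (hψ₁i x)] at hremx
    rw [integral_sub (hψi y) (hψ₁i y)] at hremy
    have hTV : dTV (P x) (P y) ≤ ENNReal.ofReal (2 * a₀) := by
      refine le_trans ?_ hsmall
      exact le_iSup₂_of_le x (by simp only [Set.mem_ofPred_eq]; linarith) <|
        le_iSup₂_of_le y (by simp only [Set.mem_ofPred_eq]; linarith) le_rfl
    have hmix := integral_sub_integral_le_of_dTV_le hψ₁m hψ₁b (by positivity) hTV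
    have hγa : γ ≤ a := ha₁γ.trans haa₁
    nlinarith [mul_nonneg (sub_nonneg.2 hγa) (mul_nonneg hβ0.le (add_nonneg hVx hVy))]

end Harris


variable {p : ℕ}

/-! ### Integrals against the Gaussian proposal -/

lemma gaussProposal_add (τ : ℝ) (x u : EuclideanSpace ℝ (Fin p)) :
    gaussProposal τ x (x + u) = gaussProposal τ 0 u := by
  simp [gaussProposal]

lemma det_gaussProposal_pos {τ : ℝ} (hτ : 0 < τ) :
    0 < ((2 * Real.pi * τ ^ 2) • (1 : Matrix (Fin p) (Fin p) ℝ)).det := by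
  rw [Matrix.det_smul, Matrix.det_one, mul_one]
  have := Real.pi_pos
  positivity

lemma gaussProposal_pos {τ : ℝ} (hτ : 0 < τ) (x y : EuclideanSpace ℝ (Fin p)) :
    0 < gaussProposal τ x y :=
  mul_pos (Real.rpow_pos_of_pos (det_gaussProposal_pos hτ) _) (Real.exp_pos _)

lemma continuous_gaussProposal (τ : ℝ) :
    Continuous fun q : EuclideanSpace ℝ (Fin p) × EuclideanSpace ℝ (Fin p) =>
      gaussProposal τ q.1 q.2 := by
  unfold gaussProposal
  fun_prop

lemma continuous_gaussProposal_zero (τ : ℝ) :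
    Continuous fun u : EuclideanSpace ℝ (Fin p) => gaussProposal τ 0 u := by
  unfold gaussProposal
  fun_prop

lemma gaussProposal_zero_eq {τ : ℝ} (u : EuclideanSpace ℝ (Fin p)) :
    gaussProposal τ 0 u =
      ((2 * Real.pi * τ ^ 2) ^ p) ^ (-(1 / 2) : ℝ) * Real.exp (-(1 / (2 * τ ^ 2)) * ‖u‖ ^ 2) := by
  unfold gaussProposal
  rw [Matrix.det_smul, Matrix.det_one, mul_one, Fintype.card_fin, sub_zero, norm_smul,
    mul_pow ‖τ⁻¹‖, norm_inv, inv_pow, Real.norm_eq_abs, sq_abs]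
  congr 2
  rw [one_div, mul_inv]
  ring

lemma integral_gaussProposal {τ : ℝ} (hτ : 0 < τ) :
    ∫ u : EuclideanSpace ℝ (Fin p), gaussProposal τ 0 u = 1 := by
  have hπ := Real.pi_pos
  simp_rw [gaussProposal_zero_eq]
  rw [integral_const_mul, GaussianFourier.integral_rexp_neg_mul_sq_norm (by positivity),
    finrank_euclideanSpace_fin, ← Real.rpow_natCast, ← Real.rpow_mul (by positivity),
    show Real.pi / (1 / (2 * τ ^ 2)) = 2 * Real.pi * τ ^ 2 by field_simp,
    ← Real.rpow_add (by positivity), show (p : ℝ) * -(1 / 2) + p / 2 = 0 by ring, Real.rpow_zero]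

lemma integrable_exp_norm_mul_gaussProposal {τ : ℝ} (hτ : 0 < τ) (s : ℝ) :
    Integrable fun u : EuclideanSpace ℝ (Fin p) => Real.exp (s * ‖u‖) * gaussProposal τ 0 u := by
  have hb : 0 < 1 / (4 * τ ^ 2) := by positivity
  have hI : Integrable fun u : EuclideanSpace ℝ (Fin p) =>
      Real.exp (-(1 / (4 * τ ^ 2)) * ‖u‖ ^ 2) := by
    refine Integrable.of_integral_ne_zero ?_
    rw [GaussianFourier.integral_rexp_neg_mul_sq_norm hb]
    have := Real.pi_pos
    positivity
  have hm : Continuous fun u : EuclideanSpace ℝ (Fin p) =>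
      Real.exp (s * ‖u‖) * gaussProposal τ 0 u :=
    (by fun_prop : Continuous fun u : EuclideanSpace ℝ (Fin p) => Real.exp (s * ‖u‖)).mul
      (continuous_gaussProposal_zero τ)
  refine (hI.const_mul (((2 * Real.pi * τ ^ 2) ^ p) ^ (-(1 / 2) : ℝ) *
    Real.exp (s ^ 2 * τ ^ 2))).mono' hm.aestronglyMeasurable
      (Filter.Eventually.of_forall fun u => ?_)
  have h0 : (0 : ℝ) ≤ ((2 * Real.pi * τ ^ 2) ^ p) ^ (-(1 / 2) : ℝ) := by
    have := Real.pi_pos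
    positivity
  rw [Real.norm_of_nonneg (mul_nonneg (Real.exp_pos _).le (gaussProposal_pos hτ _ _).le),
    gaussProposal_zero_eq, mul_left_comm, mul_assoc (_ ^ _), ← Real.exp_add, ← Real.exp_add]
  refine mul_le_mul_of_nonneg_left (Real.exp_le_exp.2 ?_) h0
  -- Completing the square: `s r ≤ r² / (4 τ²) + s² τ²`.
  have : 0 ≤ (‖u‖ / (2 * τ) - s * τ) ^ 2 := sq_nonneg _
  have e : (‖u‖ / (2 * τ) - s * τ) ^ 2 =
      s ^ 2 * τ ^ 2 + -(1 / (4 * τ ^ 2)) * ‖u‖ ^ 2 -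
        (s * ‖u‖ + -(1 / (2 * τ ^ 2)) * ‖u‖ ^ 2) := by field_simp; ring
  linarith

lemma integrable_gaussProposal {τ : ℝ} (hτ : 0 < τ) :
    Integrable fun u : EuclideanSpace ℝ (Fin p) => gaussProposal τ 0 u := by
  simpa using integrable_exp_norm_mul_gaussProposal (p := p) hτ 0

lemma integrable_sq_norm_mul_exp_mul_gaussProposal {τ : ℝ} (hτ : 0 < τ) :
    Integrable fun u : EuclideanSpace ℝ (Fin p) =>
      ‖u‖ ^ 2 * Real.exp ‖u‖ * gaussProposal τ 0 u := by
  have hm : Continuous fun u : EuclideanSpace ℝ (Fin p) =>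
      ‖u‖ ^ 2 * Real.exp ‖u‖ * gaussProposal τ 0 u :=
    (by fun_prop : Continuous fun u : EuclideanSpace ℝ (Fin p) => ‖u‖ ^ 2 * Real.exp ‖u‖).mul
      (continuous_gaussProposal_zero τ)
  refine ((integrable_exp_norm_mul_gaussProposal hτ 2).const_mul 2).mono' hm.aestronglyMeasurable
    (Filter.Eventually.of_forall fun u => ?_)
  have hq := (gaussProposal_pos hτ 0 u).le
  rw [Real.norm_of_nonneg (by positivity), ← mul_assoc]
  refine mul_le_mul_of_nonneg_right ?_ hq
  have h := Real.quadratic_le_exp_of_nonneg (norm_nonneg u)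
  have hn := norm_nonneg u
  rw [two_mul ‖u‖, Real.exp_add, ← mul_assoc]
  exact mul_le_mul_of_nonneg_right (by linarith) (Real.exp_pos _).le

lemma integrable_norm_mul_gaussProposal {τ : ℝ} (hτ : 0 < τ) :
    Integrable fun u : EuclideanSpace ℝ (Fin p) => ‖u‖ * gaussProposal τ 0 u := by
  have hm : Continuous fun u : EuclideanSpace ℝ (Fin p) => ‖u‖ * gaussProposal τ 0 u :=
    continuous_norm.mul (continuous_gaussProposal_zero τ)
  refine (integrable_exp_norm_mul_gaussProposal hτ 1).mono' hm.aestronglyMeasurable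
    (Filter.Eventually.of_forall fun u => ?_)
  have hq := (gaussProposal_pos hτ 0 u).le
  rw [Real.norm_of_nonneg (by positivity), one_mul]
  exact mul_le_mul_of_nonneg_right (by linarith [Real.add_one_le_exp ‖u‖]) hq

/-! ### The Metropolis kernel -/

lemma accept_le_one (m : EuclideanSpace ℝ (Fin p) → ℝ) (x y : EuclideanSpace ℝ (Fin p)) :
    accept m x y ≤ 1 := min_le_left _ _

lemma accept_pos {m : EuclideanSpace ℝ (Fin p) → ℝ} (hm : ∀ x, 0 < m x)
    (x y : EuclideanSpace ℝ (Fin p)) : 0 < accept m x y :=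
  lt_min one_pos (div_pos (hm y) (hm x))

lemma measurable_accept_right {m : EuclideanSpace ℝ (Fin p) → ℝ} (hm : Measurable m)
    (x : EuclideanSpace ℝ (Fin p)) : Measurable fun u => accept m x (x + u) :=
  (measurable_accept hm).comp (measurable_const.prodMk (measurable_const_add x))

lemma measurable_gaussProposal_zero (τ : ℝ) :
    Measurable fun u : EuclideanSpace ℝ (Fin p) => gaussProposal τ 0 u :=
  (continuous_gaussProposal_zero τ).measurable

lemma metropolis_apply (τ : ℝ) {m : EuclideanSpace ℝ (Fin p) → ℝ} (hm : Measurable m)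
    (x : EuclideanSpace ℝ (Fin p)) : metropolis τ m hm x =
      volume.withDensity (fun y => ENNReal.ofReal (accept m x y * gaussProposal τ x y)) +
        (∫⁻ u, ENNReal.ofReal ((1 - accept m x u) * gaussProposal τ x u)) • Measure.dirac x := rfl

/-- Integration against the Metropolis kernel, in terms of the increment `u = y - x`. -/
lemma lintegral_metropolis (τ : ℝ) {m : EuclideanSpace ℝ (Fin p) → ℝ}
    (hm : Measurable m) (x : EuclideanSpace ℝ (Fin p))
    {f : EuclideanSpace ℝ (Fin p) → ℝ≥0∞} (hf : Measurable f) :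
    ∫⁻ y, f y ∂(metropolis τ m hm x) =
      (∫⁻ u, ENNReal.ofReal (accept m x (x + u) * gaussProposal τ 0 u) * f (x + u)) +
        (∫⁻ u, ENNReal.ofReal ((1 - accept m x (x + u)) * gaussProposal τ 0 u)) * f x := by
  have hd : Measurable fun y => ENNReal.ofReal (accept m x y * gaussProposal τ x y) :=
    (((measurable_accept hm).comp measurable_prodMk_left).mul
      ((measurable_gaussProposal τ).comp measurable_prodMk_left)).ennreal_ofReal
  rw [metropolis_apply]
  rw [lintegral_add_measure, lintegral_withDensity_eq_lintegral_mul _ hd hf, lintegral_smul_measure,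
    lintegral_dirac' _ hf, smul_eq_mul]
  congr 1
  · rw [← lintegral_add_left_eq_self _ x]
    simp only [Pi.mul_apply, gaussProposal_add]
  · congr 1
    rw [← lintegral_add_left_eq_self _ x]
    simp only [gaussProposal_add]

lemma isMarkovKernel_metropolis {τ : ℝ} (hτ : 0 < τ) {m : EuclideanSpace ℝ (Fin p) → ℝ}
    (hm : Measurable m) (hpos : ∀ x, 0 < m x) : IsMarkovKernel (metropolis τ m hm) := by
  refine ⟨fun x => ⟨?_⟩⟩
  have hαq : Measurable fun u => accept m x (x + u) * gaussProposal τ 0 u :=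
    (measurable_accept_right hm x).mul (measurable_gaussProposal_zero τ)
  rw [← lintegral_one, lintegral_metropolis τ hm x measurable_const]
  simp only [mul_one]
  rw [← lintegral_add_left hαq.ennreal_ofReal]
  have : ∀ u, ENNReal.ofReal (accept m x (x + u) * gaussProposal τ 0 u) +
      ENNReal.ofReal ((1 - accept m x (x + u)) * gaussProposal τ 0 u) =
        ENNReal.ofReal (gaussProposal τ 0 u) := fun u => by
    have h0 := (gaussProposal_pos hτ 0 u).le
    rw [← ENNReal.ofReal_add (mul_nonneg (accept_pos hpos _ _).le h0)
      (mul_nonneg (sub_nonneg.2 (accept_le_one _ _ _)) h0)]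
    congr 1; ring
  simp only [this]
  rw [← ofReal_integral_eq_lintegral_ofReal (integrable_gaussProposal hτ)
    (Filter.Eventually.of_forall fun u => (gaussProposal_pos hτ 0 u).le),
    integral_gaussProposal hτ, ENNReal.ofReal_one]

/-- For `V(y) = e^{s‖y‖}` the Metropolis kernel satisfies
`P V = V · (1 + ∫ α (V(x+u)/V(x) - 1) q)`. -/
lemma lintegral_metropolis_exp_norm {τ : ℝ} (hτ : 0 < τ) {m : EuclideanSpace ℝ (Fin p) → ℝ}
    (hm : Measurable m) (hpos : ∀ x, 0 < m x) {s : ℝ} (hs : 0 ≤ s)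
    (x : EuclideanSpace ℝ (Fin p)) :
    ∫⁻ y, ENNReal.ofReal (Real.exp (s * ‖y‖)) ∂(metropolis τ m hm x) =
      ENNReal.ofReal (Real.exp (s * ‖x‖) * (1 + ∫ u, accept m x (x + u) *
        (Real.exp (s * (‖x + u‖ - ‖x‖)) - 1) * gaussProposal τ 0 u)) := by
  have hα := measurable_accept_right hm x
  have hq := measurable_gaussProposal_zero (p := p) τ
  have hq0 : ∀ u : EuclideanSpace ℝ (Fin p), 0 ≤ gaussProposal τ 0 u := fun u =>
    (gaussProposal_pos hτ 0 u).le
  have hα0 : ∀ u, 0 ≤ accept m x (x + u) := fun u => (accept_pos hpos _ _).le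
  have hα1 : ∀ u, 0 ≤ 1 - accept m x (x + u) := fun u => sub_nonneg.2 (accept_le_one _ _ _)
  have hV : Measurable fun u : EuclideanSpace ℝ (Fin p) => Real.exp (s * (‖x + u‖ - ‖x‖)) := by
    fun_prop
  have i1 : Integrable fun u => accept m x (x + u) * Real.exp (s * (‖x + u‖ - ‖x‖)) *
      gaussProposal τ 0 u := by
    refine (integrable_exp_norm_mul_gaussProposal hτ s).mono'
      ((hα.mul hV).mul hq).aestronglyMeasurable (Filter.Eventually.of_forall fun u => ?_)
    rw [Real.norm_of_nonneg (mul_nonneg (mul_nonneg (hα0 u) (Real.exp_pos _).le) (hq0 u))]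
    refine mul_le_mul_of_nonneg_right ?_ (hq0 u)
    calc accept m x (x + u) * Real.exp (s * (‖x + u‖ - ‖x‖))
        ≤ 1 * Real.exp (s * ‖u‖) := by
          refine mul_le_mul (accept_le_one _ _ _) (Real.exp_le_exp.2 ?_) (Real.exp_pos _).le
            zero_le_one
          exact mul_le_mul_of_nonneg_left (by linarith [norm_add_le x u]) hs
      _ = _ := one_mul _
  have i2 : Integrable fun u => (1 - accept m x (x + u)) * gaussProposal τ 0 u := by
    refine (integrable_gaussProposal hτ).mono'
      ((measurable_const.sub hα).mul hq).aestronglyMeasurable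
      (Filter.Eventually.of_forall fun u => ?_)
    rw [Real.norm_of_nonneg (mul_nonneg (hα1 u) (hq0 u))]
    exact mul_le_of_le_one_left (hq0 u) (by linarith [hα0 u])
  have e1 : ∀ u, ENNReal.ofReal (accept m x (x + u) * gaussProposal τ 0 u) *
      ENNReal.ofReal (Real.exp (s * ‖x + u‖)) = ENNReal.ofReal (Real.exp (s * ‖x‖) *
        (accept m x (x + u) * Real.exp (s * (‖x + u‖ - ‖x‖)) * gaussProposal τ 0 u)) := fun u => by
    rw [← ENNReal.ofReal_mul (mul_nonneg (hα0 u) (hq0 u)),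
      show s * ‖x + u‖ = s * ‖x‖ + s * (‖x + u‖ - ‖x‖) by ring, Real.exp_add]
    congr 1; ring
  have hsum : (∫ u, accept m x (x + u) * Real.exp (s * (‖x + u‖ - ‖x‖)) * gaussProposal τ 0 u) +
      ∫ u, (1 - accept m x (x + u)) * gaussProposal τ 0 u =
        1 + ∫ u, accept m x (x + u) * (Real.exp (s * (‖x + u‖ - ‖x‖)) - 1) *
          gaussProposal τ 0 u := by
    have : ∀ u, accept m x (x + u) * (Real.exp (s * (‖x + u‖ - ‖x‖)) - 1) * gaussProposal τ 0 u =
        accept m x (x + u) * Real.exp (s * (‖x + u‖ - ‖x‖)) * gaussProposal τ 0 u +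
          (1 - accept m x (x + u)) * gaussProposal τ 0 u - gaussProposal τ 0 u := fun u => by ring
    have i12 : Integrable fun u => accept m x (x + u) * Real.exp (s * (‖x + u‖ - ‖x‖)) *
        gaussProposal τ 0 u + (1 - accept m x (x + u)) * gaussProposal τ 0 u := i1.add i2
    simp_rw [this]
    rw [integral_sub i12 (integrable_gaussProposal hτ), integral_add i1 i2,
      integral_gaussProposal hτ]
    ring
  rw [lintegral_metropolis τ hm x (by fun_prop)]
  simp only [e1]
  rw [← ofReal_integral_eq_lintegral_ofReal (i1.const_mul _) (Filter.Eventually.of_forall fun u =>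
      mul_nonneg (Real.exp_pos _).le
        (mul_nonneg (mul_nonneg (hα0 u) (Real.exp_pos _).le) (hq0 u))),
    ← ofReal_integral_eq_lintegral_ofReal i2 (Filter.Eventually.of_forall fun u =>
      mul_nonneg (hα1 u) (hq0 u)),
    ← ENNReal.ofReal_mul (integral_nonneg fun u => mul_nonneg (hα1 u) (hq0 u)),
    ← ENNReal.ofReal_add, integral_const_mul, mul_comm (∫ u, _) (Real.exp (s * ‖x‖)), ← mul_add,
    hsum]
  · exact integral_nonneg fun u => mul_nonneg (Real.exp_pos _).le
      (mul_nonneg (mul_nonneg (hα0 u) (Real.exp_pos _).le) (hq0 u))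
  · exact mul_nonneg (integral_nonneg fun u => mul_nonneg (hα1 u) (hq0 u)) (Real.exp_pos _).le

/-- For a continuous positive target, all transition probabilities from a bounded set dominate a
multiple of Lebesgue measure on the unit ball; hence bounded sets are small. -/
theorem smallSublevels_metropolis {τ : ℝ} (hτ : 0 < τ) {m : EuclideanSpace ℝ (Fin p) → ℝ}
    (hm : Measurable m) (hpos : ∀ x, 0 < m x) (hc : Continuous m)
    {V : EuclideanSpace ℝ (Fin p) → ℝ} (hV : ∀ R, ∃ r, 0 ≤ r ∧ ∀ x, V x ≤ R → ‖x‖ ≤ r) :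
    SmallSublevels (metropolis τ m hm) V := by
  intro R _
  have := isMarkovKernel_metropolis hτ hm hpos
  obtain ⟨r, hr0, hr⟩ := hV R
  have hcont : Continuous fun q : EuclideanSpace ℝ (Fin p) × EuclideanSpace ℝ (Fin p) =>
      accept m q.1 q.2 * gaussProposal τ q.1 q.2 := by
    refine Continuous.mul ?_ (continuous_gaussProposal τ)
    exact continuous_const.min ((hc.comp continuous_snd).div (hc.comp continuous_fst)
      fun q => (hpos _).ne')
  obtain ⟨q₀, -, hq₀⟩ := ((isCompact_closedBall (0 : EuclideanSpace ℝ (Fin p)) r).prod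
    (isCompact_closedBall (0 : EuclideanSpace ℝ (Fin p)) 1)).exists_isMinOn
      ⟨(0, 0), by simp [hr0]⟩ hcont.continuousOn
  set ε := accept m q₀.1 q₀.2 * gaussProposal τ q₀.1 q₀.2
  have hε0 : 0 < ε := mul_pos (accept_pos hpos _ _) (gaussProposal_pos hτ _ _)
  set κ : Measure (EuclideanSpace ℝ (Fin p)) :=
    ENNReal.ofReal ε • volume.restrict (Metric.closedBall 0 1) with hκ
  have hκle : ∀ x, V x ≤ R → κ ≤ metropolis τ m hm x := by
    intro x hx
    refine Measure.le_iff.2 fun s hs => ?_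
    rw [metropolis_apply, Measure.add_apply, withDensity_apply _ hs]
    refine le_trans ?_ le_self_add
    rw [hκ, Measure.smul_apply, Measure.restrict_apply hs, smul_eq_mul, ← setLIntegral_const]
    refine (setLIntegral_mono' (hs.inter measurableSet_closedBall) fun y hy => ?_).trans
      (lintegral_mono_set Set.inter_subset_left)
    exact ENNReal.ofReal_le_ofReal (hq₀ (a := (x, y)) ⟨by simpa using hr x hx, hy.2⟩)
  have hκpos : 0 < κ.real Set.univ := by
    rw [hκ, measureReal_ennreal_smul_apply, measureReal_restrict_apply MeasurableSet.univ,
      Set.univ_inter, ENNReal.toReal_ofReal hε0.le]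
    refine mul_pos hε0 (ENNReal.toReal_pos ?_ ?_)
    · exact (Metric.measure_closedBall_pos volume _ one_pos).ne'
    · exact (isCompact_closedBall _ _).measure_lt_top.ne
  refine ⟨max (1 / 2) (1 - κ.real Set.univ), lt_max_of_lt_left (by norm_num),
    max_lt (by norm_num) (by linarith), iSup₂_le fun x hx => iSup₂_le fun y hy => ?_⟩
  refine (dTV_le_of_common_minorant (hκle x hx) (hκle y hy)).trans (ENNReal.ofReal_le_ofReal ?_)
  have := le_max_right (1 / 2) (1 - κ.real Set.univ)
  linarith


open Filter Topology

/-! ### The radial drift far from the origin -/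

/-- `m` is a Gaussian density, of covariance `(Mᵀ M)⁻¹`, perturbed by a Lipschitz function on the
logarithmic scale. The normalising constant is absorbed into that function. -/
structure IsGaussianPerturbation (m : EuclideanSpace ℝ (Fin p) → ℝ) : Prop where
  pos : ∀ x, 0 < m x
  exists_log_eq : ∃ (L : EuclideanSpace ℝ (Fin p) → ℝ) (Λ : NNReal)
    (M : EuclideanSpace ℝ (Fin p) →ₗ[ℝ] EuclideanSpace ℝ (Fin p)) (b : EuclideanSpace ℝ (Fin p)),
    LipschitzWith Λ L ∧ Function.Injective M ∧
      ∀ x, Real.log (m x) = L x - 1 / 2 * ‖M (x - b)‖ ^ 2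

lemma IsGaussianPerturbation.continuous {m : EuclideanSpace ℝ (Fin p) → ℝ}
    (hm : IsGaussianPerturbation m) : Continuous m := by
  obtain ⟨hpos, L, Λ, M, b, hL, -, hlog⟩ := hm
  have : m = fun x => Real.exp (L x - 1 / 2 * ‖M (x - b)‖ ^ 2) := by
    funext x
    rw [← hlog x, Real.exp_log (hpos x)]
  rw [this]
  have hM : Continuous M := M.continuous_of_finiteDimensional
  have := hL.continuous
  fun_prop

/-- Along a sequence that escapes to infinity in the direction `n`, the norm increment by a fixed
vector converges to the component of that vector along `n`. -/
lemma tendsto_norm_add_sub_norm {E : Type*} [NormedAddCommGroup E] [InnerProductSpace ℝ E]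
    {x : ℕ → E} {n : E} (hx : Tendsto (fun k => ‖x k‖) atTop atTop)
    (hn : Tendsto (fun k => ‖x k‖⁻¹ • x k) atTop (𝓝 n)) (hn1 : ‖n‖ = 1) (u : E) :
    Tendsto (fun k => ‖x k + u‖ - ‖x k‖) atTop (𝓝 (inner ℝ n u)) := by
  have hinv : Tendsto (fun k => ‖x k‖⁻¹) atTop (𝓝 0) := tendsto_inv_atTop_zero.comp hx
  have hnum : Tendsto (fun k => 2 * inner ℝ (‖x k‖⁻¹ • x k) u + ‖x k‖⁻¹ * ‖u‖ ^ 2) atTop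
      (𝓝 (2 * inner ℝ n u + 0 * ‖u‖ ^ 2)) :=
    ((hn.inner tendsto_const_nhds).const_mul 2).add (hinv.mul_const _)
  have hden : Tendsto (fun k => ‖‖x k‖⁻¹ • x k + ‖x k‖⁻¹ • u‖ + 1) atTop
      (𝓝 (‖n + (0 : ℝ) • u‖ + 1)) :=
    ((hn.add (hinv.smul_const u)).norm).add_const 1
  have h := hnum.div hden (by positivity)
  rw [zero_smul, add_zero, hn1, zero_mul, add_zero,
    show 2 * inner ℝ n u / (1 + 1) = inner ℝ n u by ring] at h
  refine h.congr' ?_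
  filter_upwards [hx.eventually_gt_atTop 0] with k hk
  simp only [Pi.div_apply]
  rw [← smul_add, norm_smul, norm_inv, norm_norm, real_inner_smul_left]
  have hsq : ‖x k + u‖ ^ 2 = ‖x k‖ ^ 2 + 2 * inner ℝ (x k) u + ‖u‖ ^ 2 := norm_add_sq_real _ _
  have hden' : 0 < ‖x k + u‖ + ‖x k‖ := by positivity
  rw [show 2 * (‖x k‖⁻¹ * inner ℝ (x k) u) + ‖x k‖⁻¹ * ‖u‖ ^ 2 =
      ‖x k‖⁻¹ * ((‖x k + u‖ - ‖x k‖) * (‖x k + u‖ + ‖x k‖)) by linear_combination -‖x k‖⁻¹ * hsq,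
    show ‖x k‖⁻¹ * ‖x k + u‖ + 1 = ‖x k‖⁻¹ * (‖x k + u‖ + ‖x k‖) by field_simp]
  rw [mul_div_mul_left _ _ (inv_ne_zero hk.ne'), mul_div_cancel_right₀ _ hden'.ne']

lemma accept_eq_min_exp {m : EuclideanSpace ℝ (Fin p) → ℝ} (hpos : ∀ x, 0 < m x)
    (x y : EuclideanSpace ℝ (Fin p)) :
    accept m x y = min 1 (Real.exp (Real.log (m y) - Real.log (m x))) := by
  rw [accept, Real.exp_sub, Real.exp_log (hpos y), Real.exp_log (hpos x)]

/-- Far out in the direction `n`, the moves `u` with `⟨Mᵀ M n, u⟩ < 0` are accepted and those with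
`⟨Mᵀ M n, u⟩ > 0` are rejected: the Gaussian factor dominates the Lipschitz perturbation. -/
lemma IsGaussianPerturbation.exists_tendsto_accept {m : EuclideanSpace ℝ (Fin p) → ℝ}
    (hm : IsGaussianPerturbation m) {x : ℕ → EuclideanSpace ℝ (Fin p)}
    {n : EuclideanSpace ℝ (Fin p)} (hx : Tendsto (fun k => ‖x k‖) atTop atTop)
    (hn : Tendsto (fun k => ‖x k‖⁻¹ • x k) atTop (𝓝 n)) (hn1 : ‖n‖ = 1) :
    ∃ v : EuclideanSpace ℝ (Fin p), 0 < inner ℝ n v ∧ ∀ u,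
      (inner ℝ v u < 0 → Tendsto (fun k => accept m (x k) (x k + u)) atTop (𝓝 1)) ∧
      (0 < inner ℝ v u → Tendsto (fun k => accept m (x k) (x k + u)) atTop (𝓝 0)) := by
  obtain ⟨hpos, L, Λ, M, b, hL, hM, hlog⟩ := hm
  have hn0 : n ≠ 0 := fun h => by simp [h] at hn1
  refine ⟨LinearMap.adjoint M (M n), ?_, fun u => ?_⟩
  · rw [LinearMap.adjoint_inner_right, real_inner_self_eq_norm_sq]
    have : M n ≠ 0 := fun h => hn0 (hM (h.trans (map_zero M).symm))
    positivity
  rw [LinearMap.adjoint_inner_left]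
  have hinv : Tendsto (fun k => ‖x k‖⁻¹) atTop (𝓝 0) := tendsto_inv_atTop_zero.comp hx
  have hMc : Continuous M := M.continuous_of_finiteDimensional
  have hLlim : Tendsto (fun k => ‖x k‖⁻¹ * (L (x k + u) - L (x k))) atTop (𝓝 0) := by
    refine squeeze_zero_norm (a := fun k => ‖x k‖⁻¹ * (Λ * ‖u‖)) (fun k => ?_) ?_
    · rw [norm_mul, norm_inv, norm_norm]
      have := hL.dist_le_mul (x k + u) (x k)
      rw [dist_eq_norm, dist_eq_norm, add_sub_cancel_left] at this
      gcongr
    · simpa using hinv.mul_const (Λ * ‖u‖)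
  -- The logarithm of the density ratio, divided by `‖x k‖`.
  have hr : Tendsto (fun k => ‖x k‖⁻¹ * (L (x k + u) - L (x k)) -
      inner ℝ (M (‖x k‖⁻¹ • x k)) (M u) +
        ‖x k‖⁻¹ * (inner ℝ (M b) (M u) - 1 / 2 * ‖M u‖ ^ 2)) atTop
      (𝓝 (0 - inner ℝ (M n) (M u) + 0 * (inner ℝ (M b) (M u) - 1 / 2 * ‖M u‖ ^ 2))) :=
    (hLlim.sub (((hMc.tendsto n).comp hn).inner tendsto_const_nhds)).add (hinv.mul_const _)
  rw [zero_mul, add_zero, zero_sub] at hr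
  have hdiff : ∀ᶠ k in atTop, ‖x k‖ * (‖x k‖⁻¹ * (L (x k + u) - L (x k)) -
      inner ℝ (M (‖x k‖⁻¹ • x k)) (M u) +
        ‖x k‖⁻¹ * (inner ℝ (M b) (M u) - 1 / 2 * ‖M u‖ ^ 2)) =
      Real.log (m (x k + u)) - Real.log (m (x k)) := by
    filter_upwards [hx.eventually_gt_atTop 0] with k hk
    have hsq : ‖M (x k + u - b)‖ ^ 2 =
        ‖M (x k - b)‖ ^ 2 + 2 * (inner ℝ (M (x k)) (M u) - inner ℝ (M b) (M u)) + ‖M u‖ ^ 2 := by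
      rw [show x k + u - b = (x k - b) + u by abel, map_add, norm_add_sq_real, map_sub,
        inner_sub_left]
    rw [hlog, hlog, hsq, map_smul, real_inner_smul_left]
    field_simp
    ring
  simp only [accept_eq_min_exp hpos]
  constructor
  · intro h
    have hlim : Tendsto (fun k => Real.log (m (x k + u)) - Real.log (m (x k))) atTop atTop :=
      (hx.atTop_mul_pos (neg_pos.2 h) hr).congr' hdiff
    refine tendsto_const_nhds.congr' ?_
    filter_upwards [hlim.eventually_ge_atTop 0] with k hk
    exact (min_eq_left (Real.one_le_exp hk)).symm
  · intro h
    have hlim : Tendsto (fun k => Real.log (m (x k + u)) - Real.log (m (x k))) atTop atBot :=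
      (hx.atTop_mul_neg (neg_neg_iff_pos.2 h) hr).congr' hdiff
    simpa using (tendsto_const_nhds (x := (1 : ℝ))).min (Real.tendsto_exp_atBot.comp hlim)

open Classical in
/-- The mean of `⟨n, u⟩` under the isotropic Gaussian restricted to the half-space `⟨v, u⟩ < 0` is
negative as soon as `⟨n, v⟩ > 0`: averaging over the reflection in the line spanned by `v` replaces
`⟨n, u⟩` by `⟨n, v⟩ ⟨v, u⟩ / ‖v‖²`. -/
lemma integral_halfSpace_inner_mul_gaussProposal_neg {τ : ℝ} (hτ : 0 < τ)
    {n v : EuclideanSpace ℝ (Fin p)} (hnv : 0 < inner ℝ n v) :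
    ∫ u : EuclideanSpace ℝ (Fin p),
      (if inner ℝ v u < 0 then inner ℝ n u else 0) * gaussProposal τ 0 u < 0 := by
  have hv0 : v ≠ 0 := fun h => by simp [h] at hnv
  have hvn : 0 < ‖v‖ ^ 2 := by positivity
  set f : EuclideanSpace ℝ (Fin p) → ℝ := fun u =>
    (if inner ℝ v u < 0 then inner ℝ n u else 0) * gaussProposal τ 0 u with hf
  have hfm : Measurable f := by
    refine Measurable.mul (Measurable.ite ?_ (by fun_prop) measurable_const)
      (measurable_gaussProposal_zero τ)
    exact measurableSet_lt (by fun_prop) measurable_const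
  have hfi : Integrable f := by
    refine ((integrable_norm_mul_gaussProposal hτ).const_mul ‖n‖).mono' hfm.aestronglyMeasurable
      (Eventually.of_forall fun u => ?_)
    have hq := (gaussProposal_pos hτ 0 u).le
    rw [hf, norm_mul, Real.norm_of_nonneg hq, ← mul_assoc]
    refine mul_le_mul_of_nonneg_right ?_ hq
    split_ifs
    · exact norm_inner_le_norm n u
    · rw [norm_zero]; positivity
  set ρ := (Submodule.span ℝ {v}).reflection with hρ
  have hρmp : MeasurePreserving ρ volume volume := ρ.measurePreserving
  have hρi : Integrable (fun u => f (ρ u)) := hρmp.integrable_comp_of_integrable hfi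
  have hρint : ∫ u, f (ρ u) = ∫ u, f u :=
    hρmp.integral_comp ρ.toHomeomorph.measurableEmbedding f
  have hρu : ∀ u, ρ u = (2 * (inner ℝ v u / ‖v‖ ^ 2)) • v - u := fun u => by
    rw [hρ, Submodule.reflection_singleton_apply, ← Nat.cast_smul_eq_nsmul ℝ, smul_smul]
    rfl
  have hvρ : ∀ u, inner ℝ v (ρ u) = inner ℝ v u := fun u => by
    rw [hρu, inner_sub_right, real_inner_smul_right, real_inner_self_eq_norm_sq]
    field_simp
    ring
  have hqρ : ∀ u, gaussProposal τ 0 (ρ u) = gaussProposal τ 0 u := fun u => by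
    rw [gaussProposal_zero_eq, gaussProposal_zero_eq, LinearIsometryEquiv.norm_map]
  have hsum : ∀ u, f u + f (ρ u) = (if inner ℝ v u < 0 then
      2 * (inner ℝ v u / ‖v‖ ^ 2) * inner ℝ n v else 0) * gaussProposal τ 0 u := fun u => by
    simp only [hf, hvρ, hqρ]
    rw [hρu]
    split_ifs
    · rw [inner_sub_right, real_inner_smul_right]; ring
    · ring
  have hneg : 0 < ∫ u, -(f u + f (ρ u)) := by
    rw [integral_pos_iff_support_of_nonneg]
    · have hopen : IsOpen {u : EuclideanSpace ℝ (Fin p) | inner ℝ v u < 0} :=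
        isOpen_lt (by fun_prop) continuous_const
      refine (hopen.measure_pos volume ⟨-v, ?_⟩).trans_le (measure_mono fun u hu => ?_)
      · simp only [Set.mem_ofPred_eq, inner_neg_right, real_inner_self_eq_norm_sq]
        linarith
      · have hu' : inner ℝ v u < 0 := hu
        rw [Function.mem_support, hsum, if_pos hu', neg_ne_zero]
        exact mul_ne_zero (mul_ne_zero (mul_ne_zero two_ne_zero (div_ne_zero hu'.ne hvn.ne'))
          hnv.ne') (gaussProposal_pos hτ 0 u).ne'
    · intro u
      simp only [Pi.zero_apply]
      rw [hsum, ← neg_mul]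
      refine mul_nonneg ?_ (gaussProposal_pos hτ 0 u).le
      split_ifs with h
      · have : inner ℝ v u / ‖v‖ ^ 2 < 0 := div_neg_of_neg_of_pos h hvn
        nlinarith
      · simp
    · exact (hfi.add hρi).neg
  rw [integral_neg, integral_add hfi hρi, hρint] at hneg
  linarith

/-- Outside a ball, the expected increment of the norm in one Metropolis step is bounded above by a
negative constant. -/
theorem IsGaussianPerturbation.exists_integral_norm_increment_le {τ : ℝ} (hτ : 0 < τ)
    {m : EuclideanSpace ℝ (Fin p) → ℝ} (hm : IsGaussianPerturbation m) :
    ∃ δ > 0, ∃ R : ℝ, ∀ x : EuclideanSpace ℝ (Fin p), R ≤ ‖x‖ →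
      ∫ u, accept m x (x + u) * (‖x + u‖ - ‖x‖) * gaussProposal τ 0 u ≤ -δ := by
  classical
  by_contra! hcon
  choose x hxR hxI using fun k : ℕ => hcon (1 / ((k : ℝ) + 1)) (by positivity) (k + 1)
  have hx0 : ∀ k, 0 < ‖x k‖ := fun k => lt_of_lt_of_le (by positivity) (hxR k)
  have hx : Tendsto (fun k => ‖x k‖) atTop atTop :=
    tendsto_atTop_mono (fun k => (le_add_of_nonneg_right zero_le_one).trans (hxR k))
      tendsto_natCast_atTop_atTop
  obtain ⟨n, hn, φ, hφ, hlim⟩ := (isCompact_sphere (0 : EuclideanSpace ℝ (Fin p)) 1).tendsto_subseq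
    (x := fun k => ‖x k‖⁻¹ • x k) fun k => by
      rw [mem_sphere_zero_iff_norm, norm_smul, norm_inv, norm_norm, inv_mul_cancel₀ (hx0 k).ne']
  have hn1 : ‖n‖ = 1 := by simpa using hn
  have hxφ : Tendsto (fun k => ‖x (φ k)‖) atTop atTop := hx.comp hφ.tendsto_atTop
  obtain ⟨v, hnv, hacc⟩ := hm.exists_tendsto_accept hxφ hlim hn1
  have hv0 : v ≠ 0 := fun h => by simp [h] at hnv
  have hnull : ∀ᵐ u : EuclideanSpace ℝ (Fin p), inner ℝ v u ≠ 0 := by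
    have hker : (LinearMap.ker (innerₛₗ ℝ v)) ≠ ⊤ := fun h => hv0 <| by
      have : v ∈ LinearMap.ker (innerₛₗ ℝ v) := h ▸ Submodule.mem_top
      simpa using this
    have := Measure.addHaar_submodule volume _ hker
    rw [ae_iff]
    convert this using 2
    ext u
    simp
  have hDCT : Tendsto (fun k => ∫ u, accept m (x (φ k)) (x (φ k) + u) *
      (‖x (φ k) + u‖ - ‖x (φ k)‖) * gaussProposal τ 0 u) atTop
      (𝓝 (∫ u, (if inner ℝ v u < 0 then inner ℝ n u else 0) * gaussProposal τ 0 u)) := by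
    refine tendsto_integral_of_dominated_convergence _ (fun k => ?_)
      (integrable_norm_mul_gaussProposal hτ) (fun k => Eventually.of_forall fun u => ?_) ?_
    · exact (((measurable_accept_right hm.continuous.measurable _).mul (by fun_prop)).mul
        (measurable_gaussProposal_zero τ)).aestronglyMeasurable
    · have hq := (gaussProposal_pos hτ 0 u).le
      rw [norm_mul, Real.norm_of_nonneg hq]
      refine mul_le_mul_of_nonneg_right ?_ hq
      rw [norm_mul, Real.norm_of_nonneg (accept_pos hm.pos _ _).le]
      refine (mul_le_of_le_one_left (norm_nonneg _) (accept_le_one _ _ _)).trans ?_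
      simpa using abs_norm_sub_norm_le (x (φ k) + u) (x (φ k))
    · filter_upwards [hnull] with u hu
      refine Tendsto.mul_const _ ?_
      have hnorm := tendsto_norm_add_sub_norm hxφ hlim hn1 u
      rcases lt_or_gt_of_ne hu with h | h
      · rw [if_pos h]
        simpa using ((hacc u).1 h).mul hnorm
      · rw [if_neg h.not_gt]
        simpa using ((hacc u).2 h).mul hnorm
  have hge : 0 ≤ ∫ u, (if inner ℝ v u < 0 then inner ℝ n u else 0) * gaussProposal τ 0 u := by
    have h0 : Tendsto (fun k => -(1 / ((φ k : ℝ) + 1))) atTop (𝓝 0) := by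
      simpa using ((tendsto_one_div_add_atTop_nhds_zero_nat (𝕜 := ℝ)).comp hφ.tendsto_atTop).neg
    exact le_of_tendsto_of_tendsto' h0 hDCT fun k => (hxI (φ k)).le
  exact absurd (integral_halfSpace_inner_mul_gaussProposal_neg hτ hnv) hge.not_gt

/-! ### The Lyapunov function -/

lemma exp_sub_one_le_add_sq_mul_exp_abs (t : ℝ) :
    Real.exp t - 1 ≤ t + t ^ 2 * Real.exp |t| := by
  have h1 : 1 ≤ Real.exp |t| := Real.one_le_exp (abs_nonneg t)
  have hsq := sq_nonneg t
  rcases le_or_gt |t| 1 with h | h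
  · have := (abs_le.1 (Real.abs_exp_sub_one_sub_id_le h)).2
    nlinarith
  · have h2 : 1 ≤ t ^ 2 := by rw [← sq_abs]; nlinarith
    rcases le_or_gt (-1) t with h' | h'
    · have := Real.exp_le_exp.2 (le_abs_self t)
      nlinarith
    · have : Real.exp t ≤ 1 := Real.exp_le_one_iff.2 (by linarith)
      nlinarith

/-- A second-order bound, uniform in the increment `t` with `|t| ≤ r`, for the weighted relative
increment of `e^{s t}`. -/
lemma mul_exp_sub_one_mul_le {α s t r q : ℝ} (hα0 : 0 ≤ α) (hα1 : α ≤ 1) (hs0 : 0 ≤ s)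
    (hs1 : s ≤ 1) (ht : |t| ≤ r) (hq : 0 ≤ q) :
    α * (Real.exp (s * t) - 1) * q ≤ s * (α * t * q) + s ^ 2 * (r ^ 2 * Real.exp r * q) := by
  have h1 : (s * t) ^ 2 * Real.exp |s * t| ≤ s ^ 2 * (r ^ 2 * Real.exp r) := by
    rw [mul_pow, mul_assoc, abs_mul, abs_of_nonneg hs0, ← sq_abs t]
    gcongr
    exact (mul_le_of_le_one_left (abs_nonneg t) hs1).trans ht
  have h2 : 0 ≤ s ^ 2 * (r ^ 2 * Real.exp r) := by positivity
  have h3 : α * (Real.exp (s * t) - 1) ≤ α * (s * t + s ^ 2 * (r ^ 2 * Real.exp r)) :=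
    mul_le_mul_of_nonneg_left (by linarith [exp_sub_one_le_add_sq_mul_exp_abs (s * t)]) hα0
  have h4 := mul_le_of_le_one_left h2 hα1
  calc α * (Real.exp (s * t) - 1) * q ≤ (α * (s * t) + s ^ 2 * (r ^ 2 * Real.exp r)) * q :=
        mul_le_mul_of_nonneg_right (by linarith) hq
    _ = _ := by ring

/-- The negative radial drift makes `e^{s‖x‖}` a Lyapunov function for small `s > 0`. -/
theorem IsGaussianPerturbation.exists_isLyapunov {τ : ℝ} (hτ : 0 < τ)
    {m : EuclideanSpace ℝ (Fin p) → ℝ} (hm : IsGaussianPerturbation m) (hmm : Measurable m) :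
    ∃ s > 0, IsLyapunov (metropolis τ m hmm) fun x => Real.exp (s * ‖x‖) := by
  obtain ⟨δ, hδ, R, hdrift⟩ := hm.exists_integral_norm_increment_le hτ
  have hq0 : ∀ u : EuclideanSpace ℝ (Fin p), 0 ≤ gaussProposal τ 0 u := fun u =>
    (gaussProposal_pos hτ 0 u).le
  set Q := ∫ u : EuclideanSpace ℝ (Fin p), ‖u‖ ^ 2 * Real.exp ‖u‖ * gaussProposal τ 0 u with hQ
  have hQ0 : 0 ≤ Q := integral_nonneg fun u => mul_nonneg (by positivity) (hq0 u)
  -- The exponent is small enough for the second-order term `s² Q` to be at most `s δ / 2`.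
  set s := min 1 (δ / (2 * (Q + 1))) with hs
  have hs0 : 0 < s := lt_min one_pos (by positivity)
  have hs1 : s ≤ 1 := min_le_left _ _
  have hsQ : s * Q ≤ δ / 2 := by
    have h := min_le_right 1 (δ / (2 * (Q + 1)))
    rw [← hs, le_div_iff₀ (by positivity)] at h
    nlinarith
  set I : EuclideanSpace ℝ (Fin p) → ℝ := fun x => ∫ u, accept m x (x + u) *
    (Real.exp (s * (‖x + u‖ - ‖x‖)) - 1) * gaussProposal τ 0 u with hI
  have hΔ : ∀ x u : EuclideanSpace ℝ (Fin p), |‖x + u‖ - ‖x‖| ≤ ‖u‖ := fun x u => by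
    simpa using abs_norm_sub_norm_le (x + u) x
  have hα0 : ∀ x u, 0 ≤ accept m x (x + u) := fun x u => (accept_pos hm.pos _ _).le
  have hαle : ∀ x u {t : ℝ}, 0 ≤ t → accept m x (x + u) * t ≤ t := fun x u t ht =>
    mul_le_of_le_one_left ht (accept_le_one _ _ _)
  have hexp : ∀ x u : EuclideanSpace ℝ (Fin p),
      Real.exp (s * (‖x + u‖ - ‖x‖)) ≤ Real.exp (s * ‖u‖) := fun x u =>
    Real.exp_le_exp.2 (mul_le_mul_of_nonneg_left ((le_abs_self _).trans (hΔ x u)) hs0.le)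
  have hIi : ∀ x, Integrable fun u => accept m x (x + u) *
      (Real.exp (s * (‖x + u‖ - ‖x‖)) - 1) * gaussProposal τ 0 u := fun x => by
    refine ((integrable_exp_norm_mul_gaussProposal hτ s).add
      (integrable_gaussProposal hτ)).mono' (((measurable_accept_right hmm x).mul
        (by fun_prop)).mul (measurable_gaussProposal_zero τ)).aestronglyMeasurable
      (Eventually.of_forall fun u => ?_)
    rw [norm_mul, Real.norm_of_nonneg (hq0 u), Pi.add_apply, ← add_one_mul]
    refine mul_le_mul_of_nonneg_right ?_ (hq0 u)
    rw [norm_mul, Real.norm_of_nonneg (hα0 x u)]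
    refine (hαle x u (norm_nonneg _)).trans ?_
    refine (norm_sub_le _ _).trans ?_
    rw [norm_one, Real.norm_of_nonneg (Real.exp_pos _).le]
    linarith [hexp x u]
  have hIle : ∀ x, I x ≤ ∫ u : EuclideanSpace ℝ (Fin p), Real.exp (s * ‖u‖) * gaussProposal τ 0 u :=
    fun x => integral_mono (hIi x) (integrable_exp_norm_mul_gaussProposal hτ s) fun u => by
      refine mul_le_mul_of_nonneg_right ?_ (hq0 u)
      refine (mul_le_mul_of_nonneg_left ?_ (hα0 x u)).trans (hαle x u (Real.exp_pos _).le)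
      linarith [hexp x u]
  have hDi : ∀ x, Integrable fun u => accept m x (x + u) * (‖x + u‖ - ‖x‖) *
      gaussProposal τ 0 u := fun x => by
    refine (integrable_norm_mul_gaussProposal hτ).mono' (((measurable_accept_right hmm x).mul
        (by fun_prop)).mul (measurable_gaussProposal_zero τ)).aestronglyMeasurable
      (Eventually.of_forall fun u => ?_)
    rw [norm_mul, Real.norm_of_nonneg (hq0 u)]
    refine mul_le_mul_of_nonneg_right ?_ (hq0 u)
    rw [norm_mul, Real.norm_of_nonneg (hα0 x u)]
    exact (hαle x u (norm_nonneg _)).trans (hΔ x u)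
  have hIdrift : ∀ x, R ≤ ‖x‖ → I x ≤ -(s * δ / 2) := fun x hx => by
    have h : I x ≤ ∫ u, (s * (accept m x (x + u) * (‖x + u‖ - ‖x‖) * gaussProposal τ 0 u) +
        s ^ 2 * (‖u‖ ^ 2 * Real.exp ‖u‖ * gaussProposal τ 0 u)) :=
      integral_mono (hIi x) (((hDi x).const_mul s).add
        ((integrable_sq_norm_mul_exp_mul_gaussProposal hτ).const_mul (s ^ 2))) fun u =>
          mul_exp_sub_one_mul_le (hα0 x u) (accept_le_one _ _ _) hs0.le hs1 (hΔ x u) (hq0 u)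
    rw [integral_add ((hDi x).const_mul s)
      ((integrable_sq_norm_mul_exp_mul_gaussProposal hτ).const_mul (s ^ 2)), integral_const_mul,
      integral_const_mul, ← hQ] at h
    have h5 := mul_le_mul_of_nonneg_left (hdrift x hx) hs0.le
    have h6 := mul_le_mul_of_nonneg_left hsQ hs0.le
    linarith [show s ^ 2 * Q = s * (s * Q) by ring]
  set Q' := ∫ u : EuclideanSpace ℝ (Fin p), Real.exp (s * ‖u‖) * gaussProposal τ 0 u
  have hQ'0 : 0 ≤ Q' := integral_nonneg fun u => mul_nonneg (Real.exp_pos _).le (hq0 u)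
  refine ⟨s, hs0, by fun_prop, fun x => (Real.exp_pos _).le, max (1 / 2) (1 - s * δ / 2),
    Real.exp (s * R) * (1 + Q'), lt_max_of_lt_left (by norm_num),
    max_lt (by norm_num) (by linarith [mul_pos hs0 hδ]), by positivity, fun x => ?_⟩
  rw [lintegral_metropolis_exp_norm hτ hmm hm.pos hs0.le]
  refine ENNReal.ofReal_le_ofReal ?_
  change Real.exp (s * ‖x‖) * (1 + I x) ≤ _
  have hV := Real.exp_pos (s * ‖x‖)
  have hK : 0 ≤ Real.exp (s * R) * (1 + Q') := by positivity
  rcases le_or_gt R ‖x‖ with hx | hx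
  · have h1 : 1 + I x ≤ max (1 / 2) (1 - s * δ / 2) :=
      le_trans (by linarith [hIdrift x hx]) (le_max_right _ _)
    have := mul_le_mul_of_nonneg_left h1 hV.le
    linarith
  · have h1 : Real.exp (s * ‖x‖) ≤ Real.exp (s * R) :=
      Real.exp_le_exp.2 (mul_le_mul_of_nonneg_left hx.le hs0.le)
    have h2 : Real.exp (s * ‖x‖) * (1 + I x) ≤ Real.exp (s * R) * (1 + Q') :=
      (mul_le_mul_of_nonneg_left (by linarith [hIle x]) hV.le).trans
        (mul_le_mul_of_nonneg_right h1 (by linarith))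
    have h3 : 0 ≤ max (1 / 2) (1 - s * δ / 2) * Real.exp (s * ‖x‖) :=
      mul_nonneg (le_max_of_le_left (by norm_num)) hV.le
    linarith

/-- All the assumptions and the conclusion of Harris' theorem hold for the Metropolis kernel of a
Lipschitz perturbation of a Gaussian. -/
theorem IsGaussianPerturbation.exists_harrisHolds {τ : ℝ} (hτ : 0 < τ)
    {m : EuclideanSpace ℝ (Fin p) → ℝ} (hm : IsGaussianPerturbation m) (hmm : Measurable m) :
    ∃ s > 0, HarrisHolds (metropolis τ m hmm) fun x => Real.exp (s * ‖x‖) := by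
  obtain ⟨s, hs, hLyap⟩ := hm.exists_isLyapunov hτ hmm
  have := isMarkovKernel_metropolis hτ hmm hm.pos
  have hsmall : SmallSublevels (metropolis τ m hmm) fun x => Real.exp (s * ‖x‖) := by
    refine smallSublevels_metropolis hτ hmm hm.pos hm.continuous fun R => ⟨|R| / s, by positivity,
      fun x hx => ?_⟩
    rw [le_div_iff₀ hs]
    linarith [Real.add_one_le_exp (s * ‖x‖), le_abs_self R]
  exact ⟨s, hs, hLyap, hsmall, hLyap.harrisContraction hsmall⟩

/-! ### The logistic regression posterior -/

lemma log_one_add_exp_le (s t : ℝ) :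
    Real.log (1 + Real.exp s) ≤ Real.log (1 + Real.exp t) + |s - t| := by
  rw [← Real.log_exp |s - t|, ← Real.log_mul (by positivity) (Real.exp_pos _).ne']
  refine Real.log_le_log (by positivity) ?_
  have h1 : 1 ≤ Real.exp |s - t| := Real.one_le_exp (abs_nonneg _)
  have h2 : Real.exp s ≤ Real.exp t * Real.exp |s - t| := by
    rw [← Real.exp_add]
    exact Real.exp_le_exp.2 (by linarith [le_abs_self (s - t)])
  linarith

variable {N : ℕ}

lemma lipschitzWith_logLikTerm (w : Fin N → EuclideanSpace ℝ (Fin p)) (z : Fin N → ℝ)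
    (i : Fin N) : LipschitzWith ((‖z i‖₊ + 1) * ‖w i‖₊) (logLikTerm w z i) := by
  refine LipschitzWith.of_le_add_mul _ fun x y => ?_
  have hin : |inner ℝ (w i) x - inner ℝ (w i) y| ≤ ‖w i‖ * ‖x - y‖ := by
    rw [← inner_sub_right]
    exact abs_real_inner_le_norm _ _
  have h1 := log_one_add_exp_le (inner ℝ (w i) y) (inner ℝ (w i) x)
  rw [abs_sub_comm] at h1
  have h2 : z i * (inner ℝ (w i) x - inner ℝ (w i) y) ≤ |z i| * (‖w i‖ * ‖x - y‖) := by
    refine (le_abs_self _).trans ?_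
    rw [abs_mul]
    gcongr
  rw [dist_eq_norm]
  simp only [logLikTerm]
  push_cast
  rw [Real.norm_eq_abs]
  linarith

lemma exists_lipschitzWith_mul_sum_logLikTerm (w : Fin N → EuclideanSpace ℝ (Fin p))
    (z : Fin N → ℝ) (A : Finset (Fin N)) (κ : ℝ) :
    ∃ Λ : NNReal, LipschitzWith Λ fun x => κ * ∑ i ∈ A, logLikTerm w z i x := by
  classical
  induction A using Finset.induction_on with
  | empty => exact ⟨0, by simp⟩
  | insert i A hi ih =>
    obtain ⟨Λ, hΛ⟩ := ih
    have h := ((lipschitzWith_smul κ).comp (lipschitzWith_logLikTerm w z i)).add hΛ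
    simp only [Finset.sum_insert hi, mul_add]
    exact ⟨_, h⟩

lemma injective_toEuclideanLin_rpow {B : Matrix (Fin p) (Fin p) ℝ} (hB : B.PosDef) (r : ℝ) :
    Function.Injective (Matrix.toEuclideanLin (B ^ r)) := by
  have h : B ^ (-r) * B ^ r = 1 := CFC.rpow_neg_mul_rpow r hB.isStrictlyPositive
  refine Function.LeftInverse.injective (g := Matrix.toEuclideanLin (B ^ (-r))) fun x => ?_
  simp [Matrix.toLpLin_apply, h]

lemma isGaussianPerturbation_of_hasLogDensity {m : EuclideanSpace ℝ (Fin p) → ℝ}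
    (w : Fin N → EuclideanSpace ℝ (Fin p)) (z : Fin N → ℝ) (b : EuclideanSpace ℝ (Fin p))
    {B : Matrix (Fin p) (Fin p) ℝ} (hB : B.PosDef) (A : Finset (Fin N)) (κ : ℝ)
    (hm : HasLogDensity m fun x => κ * (∑ i ∈ A, logLikTerm w z i x) + logPrior b B x) :
    IsGaussianPerturbation m := by
  obtain ⟨hpos, C, hC⟩ := hm
  obtain ⟨Λ, hΛ⟩ := exists_lipschitzWith_mul_sum_logLikTerm w z A κ
  refine ⟨hpos, fun x => κ * (∑ i ∈ A, logLikTerm w z i x) + C, Λ + 0,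
    Matrix.toEuclideanLin (B ^ (-(1 / 2) : ℝ)), b, hΛ.add (LipschitzWith.const C),
    injective_toEuclideanLin_rpow hB _, fun x => ?_⟩
  simp only [hC, logPrior]
  ring

end RWM

theorem mainTheorem10 {p N : ℕ} (τ : ℝ) (hτ : 0 < τ)
    (w : Fin N → EuclideanSpace ℝ (Fin p)) (z : Fin N → ℝ)
    (b : EuclideanSpace ℝ (Fin p)) (B : Matrix (Fin p) (Fin p) ℝ) (hB : B.PosDef) :
    (∀ (m : EuclideanSpace ℝ (Fin p) → ℝ) (hm : RWM.HasLogDensity m (RWM.logPost w z b B)),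
      ∃ c s : ℝ, 0 < c ∧ 0 < s ∧
        RWM.HarrisHolds
          (RWM.metropolis τ m (hm.measurable (RWM.measurable_logPost w z b B)))
          (fun x => c * Real.exp (s * ‖x‖))) ∧
    (∀ (A : Finset (Fin N)) (_ : A.Nonempty) (m : EuclideanSpace ℝ (Fin p) → ℝ)
      (hm : RWM.HasLogDensity m (RWM.logPostBatch w z b B A)),
      ∃ c s : ℝ, 0 < c ∧ 0 < s ∧
        RWM.IsLyapunov
          (RWM.metropolis τ m (hm.measurable (RWM.measurable_logPostBatch w z b B A)))
          (fun x => c * Real.exp (s * ‖x‖))) := by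
  refine ⟨fun m hm => ?_, fun A _ m hm => ?_⟩
  · have hG : RWM.IsGaussianPerturbation m :=
      RWM.isGaussianPerturbation_of_hasLogDensity w z b hB Finset.univ 1
        (by simp only [one_mul]; exact hm)
    obtain ⟨s, hs, h⟩ := hG.exists_harrisHolds hτ
      (hm.measurable (RWM.measurable_logPost w z b B))
    exact ⟨1, s, one_pos, hs, by simpa only [one_mul] using h⟩
  · have hG : RWM.IsGaussianPerturbation m :=
      RWM.isGaussianPerturbation_of_hasLogDensity w z b hB A _ hm
    obtain ⟨s, hs, h⟩ := hG.exists_isLyapunov hτ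
      (hm.measurable (RWM.measurable_logPostBatch w z b B A))
    exact ⟨1, s, one_pos, hs, by simpa only [one_mul] using h⟩
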